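/- Let $q$ be a prime power with $q \equiv 1 \pmod 4$, let $n=(q+1)/2$, and let $\alpha\in\mathbb F_q^*$ be an element of multiplicative order $r\ge 2$ such that $q-1=rk$ with $k$ even. Then for every integer $i$ with $2\le i\le \frac{n-1}{2}-1$ there exists an MDS convolutional code over $\mathbb F_q$ with parameters $(n,\,n-2i+1,\,2;\,1,\,2i+2)_q$. Here a polynomial matrix $G(D)=(g_{ab}(D))\in\mathbb F_q[D]^{\kappa\times n}$ is called basic if it has a polynomial right inverse. Put $\gamma_a=\max_{b}\deg g_{ab}$ (with the degree of the zero polynomial taken to be $0$); a basic matrix is called reduced if $\sum_a\gamma_a$ is smallest among all basic $\kappa\times n$ matrices generating the same submodule. A convolutional code with parameters $(n,\kappa,\gamma;m,d_f)_q$ is a submodule $C=\{u(D)G(D) : u(D)\in\mathbb F_q[D]^{\kappa}\}$ of $\mathbb F_q[D]^n$, where $G(D)\in\mathbb F_q[D]^{\kappa\times n}$ is a reduced basic matrix with $\gamma=\sum_a\gamma_a$ and $m=\max_a\gamma_a$, and where $d_f$ is the minimum of the weights of the nonzero elements of $C$, the weight of a polynomial vector being its total number of nonzero coefficients. The code is MDS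 if it attains the generalized Singleton bound, that is, $d_f=(n-\kappa)\left(\lfloor\gamma/\kappa\rfloor+1\right)+\gamma+1$. -/

import Mathlib

namespace ConvolutionalCode

open Polynomial

variable {F : Type*} [Field F] {k n : ℕ}

/-- The submodule `{u(D) G(D) | u(D) ∈ F[D]^k}` of `F[D]^n` generated by the rows of `G(D)`.
The polynomial variable `X` plays the role of the delay operator `D`. -/
noncomputable def generated (G : Matrix (Fin k) (Fin n) F[X]) : Submodule F[X] (Fin n → F[X]) :=
  LinearMap.range G.vecMulLinear

/-- The `i`-th constraint length `γ_i = max_j deg g_ij`. -/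
noncomputable def rowDegree (G : Matrix (Fin k) (Fin n) F[X]) (i : Fin k) : ℕ :=
  Finset.univ.sup fun j => (G i j).natDegree

/-- The overall constraint length `γ = ∑ i, γ_i`. -/
noncomputable def overallConstraintLength (G : Matrix (Fin k) (Fin n) F[X]) : ℕ :=
  ∑ i, rowDegree G i

/-- The memory `m = max_i γ_i`. -/
noncomputable def memory (G : Matrix (Fin k) (Fin n) F[X]) : ℕ :=
  Finset.univ.sup fun i => rowDegree G i

/-- A polynomial matrix is basic if it has a polynomial right inverse. -/
def IsBasic (G : Matrix (Fin k) (Fin n) F[X]) : Prop :=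
  ∃ R : Matrix (Fin n) (Fin k) F[X], G * R = 1

/-- A basic matrix is reduced if its overall constraint length is smallest among all basic
generator matrices of the same code. -/
def IsReducedBasic (G : Matrix (Fin k) (Fin n) F[X]) : Prop :=
  IsBasic G ∧ ∀ G' : Matrix (Fin k) (Fin n) F[X], IsBasic G' → generated G' = generated G →
    overallConstraintLength G ≤ overallConstraintLength G'

/-- The weight of a polynomial vector: its total number of nonzero coefficients. -/
def weight (v : Fin n → F[X]) : ℕ :=
  ∑ j, (v j).support.card

/-- `d` is the free distance of `C`: the minimum weight of a nonzero word. -/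
def IsFreeDistance (C : Submodule F[X] (Fin n → F[X])) (d : ℕ) : Prop :=
  IsLeast {w : ℕ | ∃ v ∈ C, v ≠ 0 ∧ weight v = w} d

/-- `C` is a convolutional code over `F` with parameters `(n, k, γ; m, d)`. -/
def HasParameters (C : Submodule F[X] (Fin n → F[X])) (k γ m d : ℕ) : Prop :=
  (∃ G : Matrix (Fin k) (Fin n) F[X], IsReducedBasic G ∧ generated G = C ∧
    overallConstraintLength G = γ ∧ memory G = m) ∧
  IsFreeDistance C d

/-- `C` is an MDS convolutional code with parameters `(n, k, γ; m, d)`: the generalized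
Singleton bound `d ≤ (n - k) (⌊γ / k⌋ + 1) + γ + 1` holds with equality. A code with these
parameters has `1 ≤ k ≤ n`, so subtraction and (floor) division of naturals are harmless. -/
def IsMDS (C : Submodule F[X] (Fin n → F[X])) (k γ m d : ℕ) : Prop :=
  HasParameters C k γ m d ∧ d = (n - k) * (γ / k + 1) + γ + 1

end ConvolutionalCode

namespace ConvolutionalCode

open Polynomial

/-! Take distinct nonzero nodes `x j`, write `M c` for the `c`-th power moment, and let `m = n - k`.
The code has parity-check matrix `H₀ + X H₁`: the rows of `H₀` are the powers `0, …, m - 1` of the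
nodes, and `H₁` has powers `m, m + 1` in its first two rows and zeros below. The lowest nonzero
coefficient vector of a word is killed by `M 0, …, M (m - 1)`, the highest by `M m, M (m + 1)`. By
the Vandermonde argument of `lt_card_support_of_moments_eq_zero` they have weights at least `m + 1`
and `3`, or at least `m + 3` if they coincide (`ParityChecks.le_weight`). A constant word on `m + 3`
positions attains this bound.

The generator matrix comes from the basis dual to the moments. It has two rows of degree one, and no
basic generator matrix does better: constant words satisfy `m + 2` independent equations, which
leaves room for only `k - 2` constant rows. -/

/-- A nonzero vector annihilated by `d` consecutive power moments at distinct nonzero nodes has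
more than `d` nonzero entries. -/
theorem lt_card_support_of_moments_eq_zero {F : Type*} [Field F] [DecidableEq F] {n : ℕ}
    {x : Fin n → F} (hx : Function.Injective x) (hx0 : ∀ j, x j ≠ 0) {u : Fin n → F}
    (hu : u ≠ 0) (s d : ℕ) (h : ∀ l < d, ∑ j, x j ^ (s + l) * u j = 0) :
    d < (Finset.univ.filter fun j => u j ≠ 0).card := by
  by_contra! hcard
  obtain ⟨j₀, hj₀⟩ := Function.ne_iff.1 hu
  set S := Finset.univ.filter fun j => u j ≠ 0 with hS
  have hjS : j₀ ∈ S := by simpa [hS] using hj₀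
  -- `p` vanishes on the support except at `j₀`, and its degree is below `d`, so pairing it with `u`
  -- gives a combination of the vanishing moments.
  set p : F[X] := ∏ j ∈ S.erase j₀, (X - C (x j)) with hp
  have hdeg : p.natDegree < d := by
    rw [hp, natDegree_prod_of_monic _ _ fun j _ => monic_X_sub_C _]
    simp only [natDegree_X_sub_C, Finset.sum_const, smul_eq_mul, mul_one]
    exact (Finset.card_erase_lt_of_mem hjS).trans_le hcard
  have hsum : ∑ j, p.eval (x j) * (x j ^ s * u j) = 0 := by
    simp_rw [eval_eq_sum_range' hdeg, Finset.sum_mul]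
    rw [Finset.sum_comm]
    refine Finset.sum_eq_zero fun l hl => ?_
    have := h l (Finset.mem_range.1 hl)
    calc ∑ j, p.coeff l * x j ^ l * (x j ^ s * u j)
        = p.coeff l * ∑ j, x j ^ (s + l) * u j := by
          rw [Finset.mul_sum]
          exact Finset.sum_congr rfl fun j _ => by ring
      _ = 0 := by rw [this, mul_zero]
  rw [Finset.sum_eq_single j₀] at hsum
  · have h1 : p.eval (x j₀) ≠ 0 := by
      rw [hp, eval_prod, Finset.prod_ne_zero_iff]
      intro j hj
      simpa [sub_eq_zero] using fun e => (Finset.ne_of_mem_erase hj) (hx e).symm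
    exact mul_ne_zero h1 (mul_ne_zero (pow_ne_zero _ (hx0 _)) hj₀) hsum
  · intro j _ hj
    by_cases huj : u j = 0
    · simp [huj]
    · have : p.eval (x j) = 0 := by
        rw [hp, eval_prod]
        refine Finset.prod_eq_zero (i := j) ?_ (by simp)
        simp [hS, hj, huj]
      simp [this]
  · simp

/-! ### Parity checks and the lower bound on weights -/

/-- The vector of coefficients of `X ^ t`. -/
def coeffVec {F : Type*} [Field F] {n : ℕ} (v : Fin n → F[X]) (t : ℕ) : Fin n → F :=
  fun j => (v j).coeff t

theorem weight_eq_sum {F : Type*} [Field F] [DecidableEq F] {n : ℕ} (v : Fin n → F[X]) {N : ℕ}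
    (hN : ∀ j, (v j).natDegree < N) :
    weight v = ∑ t ∈ Finset.range N, (Finset.univ.filter fun j => coeffVec v t j ≠ 0).card := by
  simp_rw [weight, Finset.card_filter]
  rw [Finset.sum_comm]
  refine Finset.sum_congr rfl fun j _ => ?_
  rw [← Finset.card_filter]
  congr 1
  ext t
  rw [mem_support_iff, Finset.mem_filter, Finset.mem_range, coeffVec]
  exact ⟨fun h => ⟨(le_natDegree_of_ne_zero h).trans_lt (hN j), h⟩, fun h => h.2⟩

/-- The `c`-th power moment of a polynomial vector at the nodes `x`. -/
noncomputable def moment {F : Type*} [Field F] {n : ℕ} (x : Fin n → F) (c : ℕ)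
    (v : Fin n → F[X]) : F[X] :=
  ∑ j, C (x j ^ c) * v j

theorem coeff_moment {F : Type*} [Field F] {n : ℕ} (x : Fin n → F) (c t : ℕ)
    (v : Fin n → F[X]) : (moment x c v).coeff t = ∑ j, x j ^ c * coeffVec v t j := by
  simp only [moment, coeffVec, finsetSum_coeff, coeff_C_mul]

/-- The parity check equations of the convolutional code. -/
def ParityChecks {F : Type*} [Field F] {n : ℕ} (x : Fin n → F) (m : ℕ)
    (v : Fin n → F[X]) : Prop :=
  ∀ c < m, moment x c v = if c < 2 then -X * moment x (m + c) v else 0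

theorem ParityChecks.coeff_zero {F : Type*} [Field F] {n m : ℕ} {x : Fin n → F}
    {v : Fin n → F[X]} (h : ParityChecks x m v) {c : ℕ} (hc : c < m) :
    (moment x c v).coeff 0 = 0 := by
  rw [h c hc]
  split_ifs <;> simp

theorem ParityChecks.coeff_succ {F : Type*} [Field F] {n m : ℕ} {x : Fin n → F}
    {v : Fin n → F[X]} (h : ParityChecks x m v) {c : ℕ} (hc : c < m) (t : ℕ) :
    (moment x c v).coeff (t + 1) = if c < 2 then -(moment x (m + c) v).coeff t else 0 := by
  rw [h c hc]
  split_ifs <;> simp [neg_mul, coeff_X_mul]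

theorem coeff_moment_eq_zero_of_coeffVec {F : Type*} [Field F] {n : ℕ} (x : Fin n → F)
    (c : ℕ) {t : ℕ} {v : Fin n → F[X]} (h : coeffVec v t = 0) : (moment x c v).coeff t = 0 := by
  rw [coeff_moment, h]
  simp

theorem ParityChecks.le_weight {F : Type*} [Field F] {n m : ℕ} {x : Fin n → F}
    (hx : Function.Injective x) (hx0 : ∀ j, x j ≠ 0) (hm : 2 ≤ m)
    {v : Fin n → F[X]} (h : ParityChecks x m v) (hv : v ≠ 0) : m + 3 ≤ weight v := by
  classical
  set N := (Finset.univ.sup fun j => (v j).natDegree) + 1 with hNdef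
  have hN : ∀ j, (v j).natDegree < N := fun j =>
    Nat.lt_succ_of_le (Finset.le_sup (f := fun j => (v j).natDegree) (Finset.mem_univ j))
  set T := (Finset.range N).filter fun t => coeffVec v t ≠ 0 with hT
  have hmemT : ∀ t, t ∈ T ↔ coeffVec v t ≠ 0 := by
    intro t
    simp only [hT, Finset.mem_filter, Finset.mem_range, and_iff_right_iff_imp]
    intro ht
    obtain ⟨j, hj⟩ := Function.ne_iff.1 ht
    exact (le_natDegree_of_ne_zero hj).trans_lt (hN j)
  have hTne : T.Nonempty := by
    obtain ⟨j, hj⟩ := Function.ne_iff.1 hv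
    refine ⟨(v j).natDegree, (hmemT _).2 (Function.ne_iff.2 ⟨j, ?_⟩)⟩
    simpa [coeffVec] using hj
  set a := T.min' hTne
  set b := T.max' hTne
  have haT : a ∈ T := T.min'_mem hTne
  have hbT : b ∈ T := T.max'_mem hTne
  have hlow : ∀ c < m, ∑ j, x j ^ c * coeffVec v a j = 0 := by
    intro c hc
    rw [← coeff_moment]
    rcases Nat.eq_zero_or_pos a with h0 | h0
    · rw [h0, h.coeff_zero hc]
    · obtain ⟨t, ht⟩ := Nat.exists_eq_succ_of_ne_zero h0.ne'
      have : coeffVec v t = 0 := by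
        by_contra hne
        have := T.min'_le t ((hmemT t).2 hne)
        change a ≤ t at this
        omega
      rw [ht, Nat.succ_eq_add_one, h.coeff_succ hc,
        coeff_moment_eq_zero_of_coeffVec x _ this]
      simp
  -- Compare coefficients of `X ^ (b + 1)`, where `v` itself contributes nothing.
  have hhigh : ∀ c < 2, ∑ j, x j ^ (m + c) * coeffVec v b j = 0 := by
    intro c hc
    have : coeffVec v (b + 1) = 0 := by
      by_contra hne
      have := T.le_max' (b + 1) ((hmemT _).2 hne)
      change b + 1 ≤ b at this
      omega
    have h1 := h.coeff_succ (hc.trans_le hm) b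
    rw [coeff_moment_eq_zero_of_coeffVec x _ this, if_pos hc, coeff_moment] at h1
    exact neg_eq_zero.1 h1.symm
  have haN : a ∈ Finset.range N := (Finset.mem_filter.1 haT).1
  have hbN : b ∈ Finset.range N := (Finset.mem_filter.1 hbT).1
  rw [weight_eq_sum v hN]
  set w : ℕ → ℕ := fun t => (Finset.univ.filter fun j => coeffVec v t j ≠ 0).card
  by_cases hab : a = b
  · have h1 : m + 2 < w a := by
      refine lt_card_support_of_moments_eq_zero hx hx0 ((hmemT a).1 haT) 0 (m + 2) fun l hl => ?_
      rw [zero_add]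
      rcases lt_or_ge l m with hlm | hlm
      · exact hlow l hlm
      · obtain ⟨c, rfl⟩ := Nat.exists_eq_add_of_le hlm
        rw [hab]
        exact hhigh c (by omega)
    exact h1.trans_le (Finset.single_le_sum (f := w) (fun _ _ => Nat.zero_le _) haN)
  · have h1 : m < w a := lt_card_support_of_moments_eq_zero hx hx0 ((hmemT a).1 haT) 0 m
      fun l hl => by rw [zero_add]; exact hlow l hl
    have h2 : 2 < w b :=
      lt_card_support_of_moments_eq_zero hx hx0 ((hmemT b).1 hbT) m 2 hhigh
    have h3 : w a + w b ≤ ∑ t ∈ Finset.range N, w t := by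
      rw [← Finset.sum_pair hab]
      refine Finset.sum_le_sum_of_subset fun t ht => ?_
      rcases Finset.mem_insert.1 ht with rfl | ht
      · exact haN
      · rwa [Finset.mem_singleton.1 ht]
    change m + 3 ≤ ∑ t ∈ Finset.range N, w t
    omega

/-- The parity checks are linear, so they pass from the rows of a matrix to the code. -/
theorem parityChecks_of_mem_generated {F : Type*} [Field F] {k n m : ℕ} {x : Fin n → F}
    {G : Matrix (Fin k) (Fin n) F[X]} (hG : ∀ l, ParityChecks x m (G l))
    {v : Fin n → F[X]} (hv : v ∈ generated G) : ParityChecks x m v := by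
  obtain ⟨u, rfl⟩ := hv
  have hmom : ∀ c, moment x c (G.vecMulLinear u) = ∑ l, u l * moment x c (G l) := by
    intro c
    simp only [moment, Matrix.vecMulLinear_apply, Matrix.vecMul, dotProduct, Finset.mul_sum]
    rw [Finset.sum_comm]
    exact Finset.sum_congr rfl fun l _ => Finset.sum_congr rfl fun j _ => by ring
  intro c hc
  rw [hmom, hmom, Finset.sum_congr rfl fun l _ => by rw [hG l c hc]]
  split_ifs
  · rw [Finset.mul_sum]
    exact Finset.sum_congr rfl fun l _ => by ring
  · simp

theorem row_mem_generated {F : Type*} [Field F] {k n : ℕ} (G : Matrix (Fin k) (Fin n) F[X])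
    (l : Fin k) : G l ∈ generated G :=
  ⟨Pi.single l 1, by simp [Matrix.row]⟩

/-! ### Minimality of the constraint length -/

/-- The transposed Vandermonde matrix, whose rows are the power moments. -/
def momentMatrix {F : Type*} [Field F] {n : ℕ} (x : Fin n → F) : Matrix (Fin n) (Fin n) F :=
  (Matrix.vandermonde x).transpose

theorem momentMatrix_apply {F : Type*} [Field F] {n : ℕ} (x : Fin n → F) (l j : Fin n) :
    momentMatrix x l j = x j ^ (l : ℕ) := rfl

theorem isUnit_det_momentMatrix {F : Type*} [Field F] {n : ℕ} {x : Fin n → F}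
    (hx : Function.Injective x) : IsUnit (momentMatrix x).det := by
  rw [momentMatrix, Matrix.det_transpose, isUnit_iff_ne_zero]
  exact Matrix.det_vandermonde_ne_zero_iff.2 hx

theorem eq_zero_of_moments_eq_zero {F : Type*} [Field F] {n : ℕ} {x : Fin n → F}
    (hx : Function.Injective x) {u : Fin n → F}
    (h : ∀ c < n, ∑ j, x j ^ c * u j = 0) : u = 0 := by
  refine Matrix.eq_zero_of_mulVec_eq_zero (M := momentMatrix x)
    (isUnit_det_momentMatrix hx).ne_zero (funext fun l => ?_)
  exact h l l.2

/-- If all words of the code generated by a `k`-row matrix satisfy the parity checks, a basic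
generator matrix has overall constraint length at least two. -/
theorem two_le_overallConstraintLength {F : Type*} [Field F] {k n m : ℕ} {x : Fin n → F}
    (hx : Function.Injective x) (hm : 2 ≤ m) (hmk : m + k = n) (hk : 2 ≤ k)
    {G : Matrix (Fin k) (Fin n) F[X]} (hG : IsBasic G) (hP : ∀ l, ParityChecks x m (G l)) :
    2 ≤ overallConstraintLength G := by
  by_contra! hlt
  obtain ⟨l₀, hl₀⟩ : ∃ l₀, ∀ l ≠ l₀, rowDegree G l = 0 := by
    by_cases hall : ∀ l, rowDegree G l = 0
    · exact ⟨⟨0, by omega⟩, fun l _ => hall l⟩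
    · push Not at hall
      obtain ⟨l₀, h0⟩ := hall
      refine ⟨l₀, fun l hl => ?_⟩
      have := Finset.sum_le_sum_of_subset (f := rowDegree G) (Finset.subset_univ {l, l₀})
      rw [Finset.sum_pair hl] at this
      change _ ≤ overallConstraintLength G at this
      omega
  have hcoeff : ∀ l ≠ l₀, ∀ t, coeffVec (G l) (t + 1) = 0 := by
    intro l hl t
    funext j
    refine coeff_eq_zero_of_natDegree_lt ?_
    have : (G l j).natDegree ≤ rowDegree G l :=
      Finset.le_sup (f := fun j => (G l j).natDegree) (Finset.mem_univ j)
    rw [hl₀ l hl] at this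
    omega
  have hmom : ∀ l ≠ l₀, ∀ c < m + 2, ∑ j, x j ^ c * coeffVec (G l) 0 j = 0 := by
    intro l hl c hc
    rw [← coeff_moment]
    rcases lt_or_ge c m with hcm | hcm
    · exact (hP l).coeff_zero hcm
    · obtain ⟨c, rfl⟩ := Nat.exists_eq_add_of_le hcm
      have h1 := (hP l).coeff_succ (c := c) (by omega) 0
      rw [coeff_moment_eq_zero_of_coeffVec x _ (hcoeff l hl 0), if_pos (by omega)] at h1
      exact neg_eq_zero.1 h1.symm
  obtain ⟨R, hR⟩ := hG
  set A : Matrix (Fin k) (Fin n) F := fun l => coeffVec (G l) 0 with hA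
  have hAR : A * Matrix.of (fun j l => (R j l).coeff 0) = 1 := by
    ext l l'
    have := congrArg (fun p : F[X] => p.coeff 0) (congrFun (congrFun hR l) l')
    simp only [Matrix.mul_apply, finsetSum_coeff, mul_coeff_zero] at this
    rw [Matrix.mul_apply]
    refine this.trans ?_
    rw [Matrix.one_apply, Matrix.one_apply]
    split_ifs <;> simp
  -- Combinations of the `k - 1` constant rows already have moments below `m + 2` equal to zero.
  -- Killing the other `k - 2` moments and the coefficient at `l₀` costs `k - 1 < k` conditions, so
  -- some nontrivial combination has all moments zero.
  let E : Matrix (Fin n) (Fin (k - 2)) F := fun j t => x j ^ (m + 2 + (t : ℕ))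
  let f : (Fin k → F) →ₗ[F] (Fin (k - 2) → F) × F :=
    (E.vecMulLinear ∘ₗ A.vecMulLinear).prod (LinearMap.proj l₀)
  have hker : LinearMap.ker f ≠ ⊥ := by
    refine LinearMap.ker_ne_bot_of_finrank_lt ?_
    simp only [Module.finrank_prod, Module.finrank_fin_fun, Module.finrank_self]
    omega
  obtain ⟨c, hc, hc0⟩ := Submodule.exists_mem_ne_zero_of_ne_bot hker
  have hc' : f c = 0 := hc
  have hc1 : Matrix.vecMul (Matrix.vecMul c A) E = 0 := congrArg Prod.fst hc'
  have hc2 : c l₀ = 0 := congrArg Prod.snd hc'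
  have hs : Matrix.vecMul c A = 0 := by
    refine eq_zero_of_moments_eq_zero hx fun e he => ?_
    rcases lt_or_ge e (m + 2) with hem | hem
    · simp only [Matrix.vecMul, dotProduct, Finset.mul_sum]
      rw [Finset.sum_comm]
      refine Finset.sum_eq_zero fun l _ => ?_
      by_cases hl : l = l₀
      · simp [hl, hc2]
      · calc ∑ j, x j ^ e * (c l * A l j) = c l * ∑ j, x j ^ e * coeffVec (G l) 0 j := by
              rw [Finset.mul_sum]
              exact Finset.sum_congr rfl fun j _ => by simp only [hA]; ring
          _ = 0 := by rw [hmom l hl e hem, mul_zero]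
    · have := congrFun hc1 ⟨e - (m + 2), by omega⟩
      refine Eq.trans ?_ this
      rw [Matrix.vecMul.eq_def _ E, dotProduct]
      refine Finset.sum_congr rfl fun j _ => ?_
      simp only [E]
      rw [Nat.add_sub_cancel' hem, mul_comm]
  refine hc0 ?_
  rw [← Matrix.vecMul_one c, ← hAR, ← Matrix.vecMul_vecMul, hs, Matrix.zero_vecMul]

/-! ### The generator matrix -/

/-- The generator matrix: its `l`-th row is the `(m + l)`-th dual basis vector of the power
moments, corrected for `l < 2` by `X` times the `l`-th one. -/
noncomputable def generatorMatrix {F : Type*} [Field F] {k n m : ℕ} (x : Fin n → F)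
    (hmk : m + k = n) : Matrix (Fin k) (Fin n) F[X] :=
  fun l j => C ((momentMatrix x)⁻¹ j ⟨m + l, by omega⟩) -
    if (l : ℕ) < 2 then X * C ((momentMatrix x)⁻¹ j ⟨l, by omega⟩) else 0

theorem sum_pow_mul_inv {F : Type*} [Field F] {n : ℕ} {x : Fin n → F}
    (hx : Function.Injective x) {c : ℕ} (hc : c < n) (e : Fin n) :
    ∑ j, x j ^ c * (momentMatrix x)⁻¹ j e = if c = e then 1 else 0 := by
  have := congrFun (congrFun (Matrix.mul_nonsing_inv _ (isUnit_det_momentMatrix hx)) ⟨c, hc⟩) e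
  rw [Matrix.mul_apply, Matrix.one_apply] at this
  simpa [Fin.ext_iff, momentMatrix_apply] using this

theorem moment_generatorMatrix {F : Type*} [Field F] {k n m : ℕ} {x : Fin n → F}
    (hx : Function.Injective x) (hmk : m + k = n) {c : ℕ} (hc : c < n) (l : Fin k) :
    moment x c (generatorMatrix x hmk l) =
      (if c = m + l then 1 else 0) - if (l : ℕ) < 2 ∧ c = l then X else 0 := by
  have key : ∀ e : Fin n, ∑ j, C (x j ^ c) * C ((momentMatrix x)⁻¹ j e) =
      if c = e then (1 : F[X]) else 0 := by
    intro e
    simp_rw [← C_mul]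
    rw [← map_sum, sum_pow_mul_inv hx hc e]
    split_ifs <;> simp
  simp only [moment, generatorMatrix, mul_sub, Finset.sum_sub_distrib]
  rw [key]
  congr 1
  by_cases hl : (l : ℕ) < 2
  · simp only [hl, if_true, true_and]
    calc ∑ j, C (x j ^ c) * (X * C ((momentMatrix x)⁻¹ j ⟨l, by omega⟩))
        = X * ∑ j, C (x j ^ c) * C ((momentMatrix x)⁻¹ j ⟨l, by omega⟩) := by
          rw [Finset.mul_sum]
          exact Finset.sum_congr rfl fun j _ => by ring
      _ = _ := by rw [key]; simp
  · simp [hl]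

/-- The moments `m, …, n - 1` give a constant right inverse: the `X` corrections only affect moments
`0` and `1`, which lie below `m`. -/
theorem isBasic_generatorMatrix {F : Type*} [Field F] {k n m : ℕ} {x : Fin n → F}
    (hx : Function.Injective x) (hm : 2 ≤ m) (hmk : m + k = n) :
    IsBasic (generatorMatrix x hmk) := by
  refine ⟨Matrix.of fun j l => C (x j ^ (m + (l : ℕ))), ?_⟩
  ext1 l l'
  rw [Matrix.mul_apply, Matrix.one_apply]
  have := moment_generatorMatrix hx hmk (c := m + l') (by omega) l
  rw [moment] at this
  simp_rw [Matrix.of_apply, mul_comm (generatorMatrix x hmk l _)]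
  rw [this, if_neg (show ¬((l : ℕ) < 2 ∧ m + (l' : ℕ) = l) by omega), sub_zero]
  refine if_congr ?_ rfl rfl
  rw [Fin.ext_iff]
  omega

theorem parityChecks_generatorMatrix {F : Type*} [Field F] {k n m : ℕ} {x : Fin n → F}
    (hx : Function.Injective x) (hm : 2 ≤ m) (hmk : m + k = n) (hk : 2 ≤ k) (l : Fin k) :
    ParityChecks x m (generatorMatrix x hmk l) := by
  intro c hc
  rw [moment_generatorMatrix hx hmk (by omega)]
  rw [if_neg (show ¬ c = m + (l : ℕ) by omega)]
  by_cases hc2 : c < 2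
  · rw [moment_generatorMatrix hx hmk (by omega), if_pos hc2,
      if_neg (show ¬((l : ℕ) < 2 ∧ m + c = l) by omega)]
    by_cases hcl : c = l
    · rw [if_pos ⟨by omega, hcl⟩, if_pos (by omega)]
      ring
    · rw [if_neg (by tauto), if_neg (by omega)]
      ring
  · rw [if_neg hc2, if_neg (by omega), sub_zero]

theorem rowDegree_generatorMatrix {F : Type*} [Field F] {k n m : ℕ} {x : Fin n → F}
    (hx : Function.Injective x) (hmk : m + k = n) (l : Fin k) :
    rowDegree (generatorMatrix x hmk) l = if (l : ℕ) < 2 then 1 else 0 := by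
  have hln : (l : ℕ) < n := by omega
  by_cases hl : (l : ℕ) < 2
  · rw [if_pos hl]
    refine le_antisymm (Finset.sup_le fun j _ => ?_) ?_
    · simp only [generatorMatrix, if_pos hl]
      compute_degree
    · obtain ⟨j, hj⟩ : ∃ j, (momentMatrix x)⁻¹ j ⟨l, hln⟩ ≠ 0 := by
        by_contra! h
        have := sum_pow_mul_inv hx hln ⟨l, hln⟩
        simp [h] at this
      refine le_trans ?_ (Finset.le_sup
        (f := fun j => (generatorMatrix x hmk l j).natDegree) (Finset.mem_univ j))
      refine le_natDegree_of_ne_zero ?_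
      simpa [generatorMatrix, hl, coeff_C] using hj
  · rw [if_neg hl, rowDegree, ← Nat.bot_eq_zero, Finset.sup_eq_bot_iff]
    intro j _
    simp [generatorMatrix, hl]

theorem overallConstraintLength_generatorMatrix {F : Type*} [Field F] {k n m : ℕ}
    {x : Fin n → F} (hx : Function.Injective x) (hmk : m + k = n) (hk : 2 ≤ k) :
    overallConstraintLength (generatorMatrix x hmk) = 2 := by
  obtain ⟨k, rfl⟩ := Nat.exists_eq_add_of_le' hk
  simp only [overallConstraintLength, rowDegree_generatorMatrix hx, Fin.sum_univ_succ]
  simp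

theorem memory_generatorMatrix {F : Type*} [Field F] {k n m : ℕ}
    {x : Fin n → F} (hx : Function.Injective x) (hmk : m + k = n) (hk : 2 ≤ k) :
    memory (generatorMatrix x hmk) = 1 := by
  refine le_antisymm (Finset.sup_le fun l _ => ?_) ?_
  · rw [rowDegree_generatorMatrix hx]
    split_ifs <;> simp
  · refine le_trans ?_ (Finset.le_sup (Finset.mem_univ (⟨0, by omega⟩ : Fin k)))
    simp [rowDegree_generatorMatrix hx]

/-! ### A word of minimum weight and the conclusion -/

/-- Constant vectors annihilated by the first `m + 2` moments belong to the code. -/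
theorem const_mem_generated {F : Type*} [Field F] {k n m : ℕ} {x : Fin n → F}
    (hx : Function.Injective x) (hmk : m + k = n) {w : Fin n → F}
    (hw : ∀ c < m + 2, ∑ j, x j ^ c * w j = 0) :
    (fun j => C (w j)) ∈ generated (generatorMatrix x hmk) := by
  subst hmk
  refine ⟨fun l => C (∑ j, x j ^ (m + (l : ℕ)) * w j), funext fun j => ?_⟩
  have hw' : w = Matrix.mulVec (momentMatrix x)⁻¹ (Matrix.mulVec (momentMatrix x) w) := by
    rw [Matrix.mulVec_mulVec, Matrix.nonsing_inv_mul _ (isUnit_det_momentMatrix hx),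
      Matrix.one_mulVec]
  have hj : w j = ∑ e, (momentMatrix x)⁻¹ j e * ∑ j', x j' ^ (e : ℕ) * w j' := congrFun hw' j
  rw [Fin.sum_univ_add, Finset.sum_eq_zero, zero_add] at hj
  · rw [hj, map_sum, Matrix.vecMulLinear_apply, Matrix.vecMul, dotProduct]
    refine Finset.sum_congr rfl fun l _ => ?_
    -- For these two rows the coefficient, moment `m + l` of `w`, is zero, so the terms in `X` never
    -- enter.
    by_cases hl : (l : ℕ) < 2
    · rw [hw (m + l) (by omega)]
      simp [hw (m + l) (by omega)]
    · simp only [generatorMatrix, if_neg hl, sub_zero]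
      rw [C_mul, mul_comm]
      rfl
  · intro e _
    rw [Fin.val_castAdd, hw e (by omega), mul_zero]

/-- The code contains a word of weight at most `m + 3`. -/
theorem exists_mem_generated_weight_le {F : Type*} [Field F] {k n m : ℕ} {x : Fin n → F}
    (hx : Function.Injective x) (hmk : m + k = n) (hk : 3 ≤ k) :
    ∃ v ∈ generated (generatorMatrix x hmk), v ≠ 0 ∧ weight v ≤ m + 3 := by
  classical
  let ι : Fin (m + 3) ↪ Fin n := Fin.castLEEmb (by omega)
  -- `m + 2` equations in `m + 3` unknowns; the positions exist because `3 ≤ k`.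
  let A : Matrix (Fin (m + 2)) (Fin (m + 3)) F := fun c j => x (ι j) ^ (c : ℕ)
  have hker : LinearMap.ker A.mulVecLin ≠ ⊥ := by
    refine LinearMap.ker_ne_bot_of_finrank_lt ?_
    simp
  obtain ⟨y, hy, hy0⟩ := Submodule.exists_mem_ne_zero_of_ne_bot hker
  have hy' : A.mulVec y = 0 := hy
  set w : Fin n → F := Function.extend ι y 0 with hw
  have hwι : ∀ j, w (ι j) = y j := fun j => ι.injective.extend_apply _ _ _
  have hw0 : ∀ j ∉ Finset.univ.map ι, w j = 0 := by
    intro j hj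
    refine Function.extend_apply' _ _ _ ?_
    simpa using hj
  refine ⟨fun j => C (w j), const_mem_generated hx hmk fun c hc => ?_, ?_, ?_⟩
  · rw [← Finset.sum_subset (Finset.subset_univ (Finset.univ.map ι))
      fun j _ hj => by rw [hw0 j hj, mul_zero], Finset.sum_map]
    simp_rw [hwι]
    exact congrFun hy' ⟨c, hc⟩
  · obtain ⟨j, hj⟩ := Function.ne_iff.1 hy0
    refine Function.ne_iff.2 ⟨ι j, ?_⟩
    simpa [hwι] using hj
  · rw [weight, ← Finset.sum_subset (Finset.subset_univ (Finset.univ.map ι))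
      fun j _ hj => by rw [hw0 j hj]; simp]
    refine (Finset.sum_le_card_nsmul _ _ 1 fun j _ => ?_).trans (by simp)
    exact card_support_le_one_iff_monomial.2 ⟨0, w j, rfl⟩

/-- Over any field with `n` distinct nonzero elements there is an MDS convolutional code with
parameters `(n, k, 2; 1, n - k + 3)` whenever `3 ≤ k ≤ n - 2`. -/
theorem exists_isMDS {F : Type*} [Field F] {k n m : ℕ} {x : Fin n → F}
    (hx : Function.Injective x) (hx0 : ∀ j, x j ≠ 0) (hm : 2 ≤ m) (hmk : m + k = n)
    (hk : 3 ≤ k) : ∃ C : Submodule F[X] (Fin n → F[X]), IsMDS C k 2 1 (m + 3) := by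
  have hpar : ∀ {v}, v ∈ generated (generatorMatrix x hmk) → ParityChecks x m v := fun hv =>
    parityChecks_of_mem_generated
      (parityChecks_generatorMatrix hx hm hmk (Nat.le_of_succ_le hk)) hv
  have hwt : ∀ {v}, v ∈ generated (generatorMatrix x hmk) → v ≠ 0 → m + 3 ≤ weight v :=
    fun hv hv0 => (hpar hv).le_weight hx hx0 hm hv0
  refine ⟨generated (generatorMatrix x hmk), ⟨⟨generatorMatrix x hmk,
    ⟨isBasic_generatorMatrix hx hm hmk, fun G' hG' hgen => ?_⟩, rfl,
    overallConstraintLength_generatorMatrix hx hmk (by omega),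
    memory_generatorMatrix hx hmk (by omega)⟩, ?_, ?_⟩, ?_⟩
  · rw [overallConstraintLength_generatorMatrix hx hmk (by omega)]
    exact two_le_overallConstraintLength hx hm hmk (by omega) hG' fun l =>
      hpar (hgen ▸ row_mem_generated G' l)
  · obtain ⟨v, hv, hv0, hle⟩ := exists_mem_generated_weight_le hx hmk hk
    exact ⟨v, hv, hv0, le_antisymm hle (hwt hv hv0)⟩
  · rintro _ ⟨v, hv, hv0, rfl⟩
    exact hwt hv hv0
  · rw [Nat.div_eq_of_lt (by omega), ← hmk]
    simp

end ConvolutionalCode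

theorem mainTheorem8 {F : Type*} [Field F] [Fintype F] (q n r k : ℕ)
    (hcard : Fintype.card F = q) (hq : q % 4 = 1) (hn : n = (q + 1) / 2)
    (α : Fˣ) (hα : orderOf α = r) (hr : 2 ≤ r) (hrk : q - 1 = r * k) (hk : Even k)
    (i : ℕ) (hi : 2 ≤ i) (hi' : i ≤ (n - 1) / 2 - 1) :
    ∃ C : Submodule (Polynomial F) (Fin n → Polynomial F),
      ConvolutionalCode.IsMDS C (n - 2 * i + 1) 2 1 (2 * i + 2) := by
  classical
  have hle : Fintype.card (Fin n) ≤ Fintype.card Fˣ := by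
    rw [Fintype.card_fin, Fintype.card_units, hcard]
    omega
  obtain ⟨e⟩ := Function.Embedding.nonempty_of_card_le hle
  have := ConvolutionalCode.exists_isMDS (x := fun j => (e j : F)) (m := 2 * i - 1)
    (k := n - 2 * i + 1) (Units.val_injective.comp e.injective) (fun j => (e j).ne_zero)
    (by omega) (by omega) (by omega)
  rwa [show 2 * i - 1 + 3 = 2 * i + 2 by omega] at this
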